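/- Let $n\ge 0$, let $\mathbb{S}^{n}=\{x\in\mathbb{R}^{n+1}:\|x\|=1\}$ be the unit sphere with the round Riemannian metric (the one induced by the inclusion in $\mathbb{R}^{n+1}$), and let $\nabla_{\mathbb{S},x}$ denote the Riemannian gradient on $\mathbb{S}^n$ in the variable $x$. For $\kappa>0$ let $k_\kappa(x,y)=\exp(\kappa\,x^\top y)$, $x,y\in\mathbb{S}^n$, be the von Mises–Fisher kernel. Then: 1. (Characteristic.) $k_\kappa$ is characteristic on the set $\mathcal{P}(\mathbb{S}^n)$ of Borel probability measures on $\mathbb{S}^n$. That is, $k_\kappa$ is a positive definite kernel (symmetric, with $\sum_{i,j}c_ic_jk_\kappa(x_i,x_j)\ge 0$ for all finite families of points $x_i\in\mathbb{S}^n$ and reals $c_i$), and the mean embedding $\mu\mapsto\int_{\mathbb{S}^n}k_\kappa(\cdot,y)\,d\mu(y)$ is well defined and injective on $\mathcal{P}(\mathbb{S}^n)$. 2. (Uniform gradient bound.) $\sup_{x,y\in\mathbb{S}^n}\|\nabla_{\mathbb{S},x}k_\kappa(x,y)\|<\infty$; more precisely, $\|\nabla_{\mathbb{S},x}k_\kappa(x,y)\|\le\kappa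 e^{\kappa}$ for all $x,y\in\mathbb{S}^n$. 3. (Strict positivity.) $k_\kappa(x,y)>0$ for all $x,y\in\mathbb{S}^n$. 4. (Smoothness.) For every $y\in\mathbb{S}^n$ the map $x\mapsto k_\kappa(x,y)$ is $C^1$ on $\mathbb{S}^n$; moreover $k_\kappa$ is $C^\infty$ on $\mathbb{S}^n\times\mathbb{S}^n$. -/

import Mathlib

open scoped Manifold ContDiff

noncomputable section

/-- The unit sphere `S^n` in `ℝ^(n+1)`, with Mathlib's smooth manifold structure of dimension `n`,
its subspace topology and its Borel `σ`-algebra. -/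
abbrev USphere (n : ℕ) : Type := Metric.sphere (0 : EuclideanSpace ℝ (Fin (n + 1))) 1

/-- The differential at `x` of the inclusion of the sphere into the ambient Euclidean space. -/
def inclusionDeriv {n : ℕ} (x : USphere n) :
    TangentSpace (𝓡 n) x →L[ℝ] EuclideanSpace ℝ (Fin (n + 1)) :=
  mvfderiv (𝓡 n) (fun z : USphere n => (z : EuclideanSpace ℝ (Fin (n + 1)))) x

theorem inclusionDeriv_injective {n : ℕ} (x : USphere n) :
    Function.Injective (inclusionDeriv x) := by
  have : Fact (Module.finrank ℝ (EuclideanSpace ℝ (Fin (n + 1))) = n + 1) :=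
    ⟨finrank_euclideanSpace_fin⟩
  exact injective_mvfderiv_subtypeVal_sphere x

/-- The round metric at `x`: the pullback of the Euclidean inner product under the inclusion. -/
def roundMetric {n : ℕ} (x : USphere n) : LinearMap.BilinForm ℝ (TangentSpace (𝓡 n) x) :=
  (innerₗ (EuclideanSpace ℝ (Fin (n + 1)))).compl₁₂
    (inclusionDeriv x).toLinearMap (inclusionDeriv x).toLinearMap

theorem roundMetric_apply {n : ℕ} (x : USphere n) (v w : TangentSpace (𝓡 n) x) :
    roundMetric x v w = inner ℝ (inclusionDeriv x v) (inclusionDeriv x w) := rfl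

theorem roundMetric_nondegenerate {n : ℕ} (x : USphere n) : (roundMetric x).Nondegenerate := by
  have key : ∀ v, roundMetric x v v = 0 → v = 0 := by
    intro v hv
    rw [roundMetric_apply, inner_self_eq_zero] at hv
    exact inclusionDeriv_injective x (hv.trans (map_zero _).symm)
  exact ⟨fun v hv => key v (hv v), fun v hv => key v (hv v)⟩

instance instFiniteDimensionalTangentSphere {n : ℕ} (x : USphere n) :
    FiniteDimensional ℝ (TangentSpace (𝓡 n) x) :=
  inferInstanceAs (FiniteDimensional ℝ (EuclideanSpace ℝ (Fin n)))

/-- The Riemannian gradient of `f` at `x` for the round metric. -/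
def sphereGradient {n : ℕ} (f : USphere n → ℝ) (x : USphere n) : TangentSpace (𝓡 n) x :=
  ((roundMetric x).toDual (roundMetric_nondegenerate x)).symm
    (mvfderiv (𝓡 n) f x).toLinearMap

/-- The defining property of the Riemannian gradient: `g_x(∇f(x), v) = df_x(v)`. -/
theorem roundMetric_sphereGradient {n : ℕ} (f : USphere n → ℝ) (x : USphere n)
    (v : TangentSpace (𝓡 n) x) :
    roundMetric x (sphereGradient f x) v = mvfderiv (𝓡 n) f x v :=
  LinearMap.BilinForm.apply_toDual_symm_apply ..

/-- The length of a tangent vector for the round metric. -/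
def roundNorm {n : ℕ} (x : USphere n) (v : TangentSpace (𝓡 n) x) : ℝ :=
  √(roundMetric x v v)

/-- The kernel `k` is characteristic on the Borel probability measures of the sphere: it is positive
definite (in the usual kernel sense: symmetric, with nonnegative quadratic forms on finite families
of points), and the mean embedding `μ ↦ ∫ k(·, y) dμ(y)` is well defined and injective. -/
def IsCharacteristicOnSphere {n : ℕ} (k : USphere n → USphere n → ℝ) : Prop :=
  (Matrix.of k).PosSemidef ∧
  (∀ (μ : MeasureTheory.ProbabilityMeasure (USphere n)) (x : USphere n),
    MeasureTheory.Integrable (k x) (μ : MeasureTheory.Measure (USphere n))) ∧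
  Function.Injective (fun (μ : MeasureTheory.ProbabilityMeasure (USphere n)) (x : USphere n) =>
    ∫ y, k x y ∂(μ : MeasureTheory.Measure (USphere n)))

/-- The Riemannian gradient of `k` in its first variable is uniformly bounded:
`sup_{x,y} ‖∇_x k(x, y)‖ < ∞`. -/
def HasBoundedSphereGradient {n : ℕ} (k : USphere n → USphere n → ℝ) : Prop :=
  BddAbove (Set.range fun p : USphere n × USphere n =>
    roundNorm p.1 (sphereGradient (fun x => k x p.2) p.1))

/-- The kernel regularity assumptions on the sphere. -/
structure SphericalKernelRegularity {n : ℕ} (k : USphere n → USphere n → ℝ) : Prop where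
  characteristic : IsCharacteristicOnSphere k
  bounded_gradient : HasBoundedSphereGradient k
  pos : ∀ x y, 0 < k x y
  contMDiff_left : ∀ y, ContMDiff (𝓡 n) 𝓘(ℝ, ℝ) 1 (fun x => k x y)

/-- The von Mises–Fisher kernel `exp(κ x·y)` on the sphere. -/
def vmfKernel (n : ℕ) (κ : ℝ) (x y : USphere n) : ℝ :=
  Real.exp (κ * inner ℝ (x : EuclideanSpace ℝ (Fin (n + 1))) (y : EuclideanSpace ℝ (Fin (n + 1))))

end

/-!
The von Mises–Fisher kernel is treated through an explicit feature expansion. Expanding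
`exp (κ * t)` in its Taylor series at `t = x · y`, and each power `(x · y) ^ m` into monomials, gives
`k x y = ∑ i, φ i x * φ i y`, where the `φ i` are the monomials in the coordinates with positive
weights and `∑ i, ‖φ i‖ ^ 2` is finite (`hasSum_vmfFeature_mul`, `summable_norm_sq_vmfFeature`).

Positive definiteness is immediate from such an expansion. For injectivity of the mean embedding,
suppose that the embeddings of `μ` and `ν` agree, and let `D i` be the difference of the integrals of
`φ i` against `μ` and `ν`. Then `∑ i, D i * φ i x = 0` for every `x`; integrating once more against
`μ - ν` gives `∑ i, D i ^ 2 = 0`, so all `D i` vanish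
(`integral_feature_eq_of_integral_kernel_eq`). Since every weight is nonzero, `μ` and `ν` integrate
all monomials equally, and they coincide by the Stone–Weierstrass theorem
(`MeasureTheory.ProbabilityMeasure.ext_of_integral_submonoid`).

Smoothness holds because the kernel is the restriction of a smooth function on the ambient space.
Its differential in the first variable is `v ↦ κ * k x y * ⟪dι v, y⟫`, where `ι` is the inclusion of
the sphere; by the Cauchy–Schwarz inequality this is at most `κ * exp κ` times the length of `v`, and
the gradient satisfies the same bound (`roundNorm_sphereGradient_le`).
-/

open MeasureTheory

/-! ### Kernels given by a series of feature functions -/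

/-- A kernel `k x y = ∑ i, φ i x * φ i y` is positive semidefinite: its quadratic forms are sums of
the squares `(∑ x, c x * φ i x) ^ 2`. -/
theorem posSemidef_of_hasSum_mul {X ι : Type*} {φ : ι → X → ℝ} {k : X → X → ℝ}
    (hk : ∀ x y, HasSum (fun i => φ i x * φ i y) (k x y)) : (Matrix.of k).PosSemidef := by
  refine ⟨Matrix.IsHermitian.ext fun x y => ?_, fun c => ?_⟩
  · simpa [mul_comm] using (hk y x).unique (by simpa [mul_comm] using hk x y)
  · have h : HasSum (fun i => ∑ x ∈ c.support, ∑ y ∈ c.support, c x * (φ i x * φ i y) * c y)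
        (∑ x ∈ c.support, ∑ y ∈ c.support, c x * k x y * c y) :=
      hasSum_sum fun x _ => hasSum_sum fun y _ => ((hk x y).mul_left _).mul_right _
    refine h.nonneg fun i => ?_
    have : ∑ x ∈ c.support, ∑ y ∈ c.support, c x * (φ i x * φ i y) * c y
        = (∑ x ∈ c.support, c x * φ i x) ^ 2 := by
      rw [sq, Finset.sum_mul_sum]
      exact Finset.sum_congr rfl fun x _ => Finset.sum_congr rfl fun y _ => by ring
    rw [this]
    positivity

section MeanEmbedding

variable {X ι : Type*} [TopologicalSpace X] [CompactSpace X] [MeasurableSpace X]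

theorem ContinuousMap.norm_integral_le_norm (μ : Measure X) [IsProbabilityMeasure μ]
    (g : C(X, ℝ)) : ‖∫ x, g x ∂μ‖ ≤ ‖g‖ := by
  simpa using norm_integral_le_of_norm_le_const (μ := μ) (ae_of_all _ g.norm_coe_le_norm)

variable [BorelSpace X]

theorem ContinuousMap.integrable_of_isFiniteMeasure (μ : Measure X) [IsFiniteMeasure μ]
    (g : C(X, ℝ)) : Integrable g μ :=
  Integrable.of_bound g.continuous.measurable.aestronglyMeasurable ‖g‖
    (ae_of_all _ g.norm_coe_le_norm)

theorem ContinuousMap.hasSum_mul_integral [Countable ι] (μ : Measure X) [IsProbabilityMeasure μ]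
    {φ : ι → C(X, ℝ)} {a : ι → ℝ} {s : X → ℝ} (ha : Summable fun i => |a i| * ‖φ i‖)
    (hs : ∀ x, HasSum (fun i => a i * φ i x) (s x)) :
    HasSum (fun i => a i * ∫ x, φ i x ∂μ) (∫ x, s x ∂μ) := by
  have h := hasSum_integral_of_summable_integral_norm (μ := μ) (F := fun i x => a i * φ i x)
    (fun i => ((φ i).integrable_of_isFiniteMeasure μ).const_mul _)
    (ha.of_nonneg_of_le (fun i => integral_nonneg fun x => norm_nonneg _) fun i => ?_)
  · simpa only [integral_const_mul, (hs _).tsum_eq] using h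
  · refine (le_abs_self _).trans ?_
    simpa using norm_integral_le_of_norm_le_const (μ := μ) (f := fun x => ‖a i * φ i x‖)
      (C := |a i| * ‖φ i‖) (ae_of_all _ fun x => by
        simpa [abs_mul] using mul_le_mul_of_nonneg_left ((φ i).norm_coe_le_norm x) (abs_nonneg _))

/-- If the mean embeddings of `μ` and `ν` under `k x y = ∑ i, φ i x * φ i y` agree, then so do the
integrals of every feature `φ i`. With `D i` the difference of the two integrals of `φ i`,
integrating `0 = ∑ i, D i * φ i x` against `μ - ν` gives `∑ i, D i ^ 2 = 0`. -/
theorem integral_feature_eq_of_integral_kernel_eq [Countable ι] (μ ν : Measure X)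
    [IsProbabilityMeasure μ] [IsProbabilityMeasure ν] {φ : ι → C(X, ℝ)} {k : X → X → ℝ}
    (hφ : Summable fun i => ‖φ i‖ ^ 2) (hk : ∀ x y, HasSum (fun i => φ i x * φ i y) (k x y))
    (h : ∀ x, ∫ y, k x y ∂μ = ∫ y, k x y ∂ν) (i : ι) :
    ∫ x, φ i x ∂μ = ∫ x, φ i x ∂ν := by
  set D : ι → ℝ := fun i => ∫ x, φ i x ∂μ - ∫ x, φ i x ∂ν with hD
  have hsum : ∀ x, Summable fun i => |φ i x| * ‖φ i‖ := fun x =>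
    hφ.of_nonneg_of_le (fun i => by positivity) fun i => by
      rw [sq]
      exact mul_le_mul_of_nonneg_right ((φ i).norm_coe_le_norm x) (norm_nonneg _)
  have hzero : ∀ x, HasSum (fun i => D i * φ i x) 0 := fun x => by
    have := (ContinuousMap.hasSum_mul_integral μ (hsum x) (hk x)).sub
      (ContinuousMap.hasSum_mul_integral ν (hsum x) (hk x))
    rw [h x, sub_self] at this
    exact this.congr_fun fun i => by simp only [hD]; ring
  have hDsum : Summable fun i => |D i| * ‖φ i‖ :=
    (hφ.mul_left 2).of_nonneg_of_le (fun i => by positivity) fun i => by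
      have : |D i| ≤ 2 * ‖φ i‖ := by
        have h₁ := (φ i).norm_integral_le_norm μ
        have h₂ := (φ i).norm_integral_le_norm ν
        have h₃ := norm_sub_le (∫ x, φ i x ∂μ) (∫ x, φ i x ∂ν)
        rw [← Real.norm_eq_abs]
        linarith
      nlinarith [norm_nonneg (φ i)]
  have hsq : HasSum (fun i => D i ^ 2) 0 := by
    have := (ContinuousMap.hasSum_mul_integral μ hDsum hzero).sub
      (ContinuousMap.hasSum_mul_integral ν hDsum hzero)
    rw [integral_zero, integral_zero, sub_self] at this
    exact this.congr_fun fun i => by simp only [hD]; ring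
  have := congrFun ((hasSum_zero_iff_of_nonneg fun i => sq_nonneg (D i)).1 hsq) i
  exact sub_eq_zero.1 (pow_eq_zero_iff two_ne_zero |>.1 this)

/-- Two probability measures on a compact space are equal when they integrate all elements of a
multiplicative family of continuous functions separating points equally. -/
theorem MeasureTheory.ProbabilityMeasure.ext_of_integral_submonoid [HasOuterApproxClosed X]
    (μ ν : ProbabilityMeasure X) (M : Submonoid C(X, ℝ))
    (hM : ∀ x y, x ≠ y → ∃ g ∈ M, g x ≠ g y)
    (h : ∀ g ∈ M, ∫ x, g x ∂(μ : Measure X) = ∫ x, g x ∂(ν : Measure X)) : μ = ν := by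
  have hcont : ∀ μ : ProbabilityMeasure X, Continuous fun g : C(X, ℝ) => ∫ x, g x ∂(μ : Measure X) :=
    fun μ => (LipschitzWith.of_dist_le_mul (K := 1) fun f g => by
      rw [dist_eq_norm, dist_eq_norm, ← integral_sub (f.integrable_of_isFiniteMeasure _)
        (g.integrable_of_isFiniteMeasure _)]
      simpa using (f - g).norm_integral_le_norm (μ : Measure X)).continuous
  set A := Algebra.adjoin ℝ (M : Set C(X, ℝ)) with hA
  have hAint : ∀ g ∈ A, ∫ x, g x ∂(μ : Measure X) = ∫ x, g x ∂(ν : Measure X) := by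
    intro g hg
    rw [hA, ← Subalgebra.mem_toSubmodule, Algebra.adjoin_eq_span, Submonoid.closure_eq] at hg
    induction hg using Submodule.span_induction with
    | mem g hg => exact h g hg
    | zero => simp
    | add f g _ _ hf hg =>
      simp only [ContinuousMap.add_apply]
      rw [integral_add, integral_add, hf, hg] <;> exact ContinuousMap.integrable_of_isFiniteMeasure _ _
    | smul c g _ hg => simp only [ContinuousMap.smul_apply, integral_smul, hg]
  have hsep : A.SeparatesPoints := fun x y hxy => by
    obtain ⟨g, hg, hne⟩ := hM x y hxy
    exact ⟨g, ⟨g, Algebra.subset_adjoin hg, rfl⟩, hne⟩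
  have htop := ContinuousMap.subalgebra_topologicalClosure_eq_top_of_separatesPoints A hsep
  have hall : ∀ g : C(X, ℝ), ∫ x, g x ∂(μ : Measure X) = ∫ x, g x ∂(ν : Measure X) := fun g => by
    have hg : g ∈ closure (A : Set C(X, ℝ)) := by
      rw [← Subalgebra.topologicalClosure_coe, htop]
      trivial
    exact closure_minimal (t := {g : C(X, ℝ) | _ = _}) hAint
      (isClosed_eq (hcont μ) (hcont ν)) hg
  refine Subtype.ext (ext_of_forall_integral_eq_of_IsFiniteMeasure (μ := (μ : Measure X))
    (ν := (ν : Measure X)) fun g => hall g.toContinuousMap)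

end MeanEmbedding

/-! ### The monomial features of the von Mises–Fisher kernel -/

/-- The degree `m` monomial `x ↦ ∏ j, x (f j)` on the sphere. Monomials are indexed by words
`f : Fin m → Fin (n + 1)` in the coordinates, so that a monomial with several orderings is listed
once for each of them. -/
def sphereMonomial {n m : ℕ} (f : Fin m → Fin (n + 1)) : C(USphere n, ℝ) where
  toFun x := ∏ j, (x : EuclideanSpace ℝ (Fin (n + 1))) (f j)
  continuous_toFun := by fun_prop

theorem sphereMonomial_apply {n m : ℕ} (f : Fin m → Fin (n + 1)) (x : USphere n) :
    sphereMonomial f x = ∏ j, (x : EuclideanSpace ℝ (Fin (n + 1))) (f j) := rfl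

theorem norm_sphereMonomial_le_one {n m : ℕ} (f : Fin m → Fin (n + 1)) :
    ‖sphereMonomial f‖ ≤ 1 := by
  refine (ContinuousMap.norm_le _ zero_le_one).2 fun x => ?_
  rw [sphereMonomial_apply, norm_prod]
  refine Finset.prod_le_one (fun _ _ => norm_nonneg _) fun j _ => ?_
  simpa using PiLp.norm_apply_le (x : EuclideanSpace ℝ (Fin (n + 1))) (f j)

/-- Expanding the `m`-th power of `x · y = ∑ i, x i * y i` over all words of length `m`. -/
theorem sum_sphereMonomial_mul {n : ℕ} (m : ℕ) (x y : USphere n) :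
    ∑ f : Fin m → Fin (n + 1), sphereMonomial f x * sphereMonomial f y =
      inner ℝ (x : EuclideanSpace ℝ (Fin (n + 1))) (y : EuclideanSpace ℝ (Fin (n + 1))) ^ m := by
  simp only [sphereMonomial_apply, ← Finset.prod_mul_distrib]
  rw [← Fintype.prod_sum fun (_ : Fin m) i =>
    (x : EuclideanSpace ℝ (Fin (n + 1))) i * (y : EuclideanSpace ℝ (Fin (n + 1))) i]
  simp [PiLp.inner_apply, mul_comm]

/-- The features of the von Mises–Fisher kernel: monomials scaled by `√(κ ^ m / m!)`, the square
root of the Taylor coefficient of `t ↦ exp (κ * t)`. -/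
noncomputable def vmfFeature (n : ℕ) (κ : ℝ) (i : Σ m : ℕ, Fin m → Fin (n + 1)) : C(USphere n, ℝ) :=
  √(κ ^ i.1 / i.1.factorial) • sphereMonomial i.2

theorem summable_norm_sq_vmfFeature (n : ℕ) {κ : ℝ} (hκ : 0 ≤ κ) :
    Summable fun i => ‖vmfFeature n κ i‖ ^ 2 := by
  have hle : ∀ i, ‖vmfFeature n κ i‖ ^ 2 ≤ κ ^ i.1 / i.1.factorial := fun i => by
    have h0 : 0 ≤ κ ^ i.1 / i.1.factorial := by positivity
    rw [vmfFeature, norm_smul, mul_pow, Real.norm_eq_abs, sq_abs, Real.sq_sqrt h0]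
    exact mul_le_of_le_one_right h0 (pow_le_one₀ (norm_nonneg _) (norm_sphereMonomial_le_one _))
  refine Summable.of_nonneg_of_le (fun i => sq_nonneg _) hle ?_
  refine (summable_sigma_of_nonneg fun i => by positivity).2
    ⟨fun m => (hasSum_fintype _).summable, ?_⟩
  simpa [mul_pow, mul_div_assoc] using Real.summable_pow_div_factorial ((n + 1) * κ)

theorem hasSum_vmfFeature_mul (n : ℕ) {κ : ℝ} (hκ : 0 ≤ κ) (x y : USphere n) :
    HasSum (fun i => vmfFeature n κ i x * vmfFeature n κ i y) (vmfKernel n κ x y) := by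
  have hfiber : ∀ m : ℕ, HasSum
      (fun f : Fin m → Fin (n + 1) => vmfFeature n κ ⟨m, f⟩ x * vmfFeature n κ ⟨m, f⟩ y)
      ((κ * inner ℝ (x : EuclideanSpace ℝ (Fin (n + 1)))
        (y : EuclideanSpace ℝ (Fin (n + 1)))) ^ m / m.factorial) := fun m => by
    convert! hasSum_fintype _ using 1
    have h0 : 0 ≤ κ ^ m / m.factorial := by positivity
    rw [mul_pow, ← sum_sphereMonomial_mul, mul_div_right_comm, Finset.mul_sum]
    refine Finset.sum_congr rfl fun f _ => ?_
    simp only [vmfFeature, ContinuousMap.smul_apply, smul_eq_mul]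
    rw [mul_mul_mul_comm, Real.mul_self_sqrt h0]
  have hsummable : Summable fun i => vmfFeature n κ i x * vmfFeature n κ i y :=
    (summable_norm_sq_vmfFeature n hκ).of_norm_bounded fun i => by
      rw [norm_mul, sq]
      exact mul_le_mul ((vmfFeature n κ i).norm_coe_le_norm x)
        ((vmfFeature n κ i).norm_coe_le_norm y) (norm_nonneg _) (norm_nonneg _)
  have h := hsummable.hasSum
  have hexp := h.sigma hfiber
  rw [vmfKernel, Real.exp_eq_exp_ℝ]
  rwa [hexp.unique (NormedSpace.expSeries_div_hasSum_exp _)] at h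

/-- The monomials form a monoid: words multiply by concatenation. -/
def sphereMonomials (n : ℕ) : Submonoid C(USphere n, ℝ) where
  carrier := {g | ∃ (m : ℕ) (f : Fin m → Fin (n + 1)), sphereMonomial f = g}
  one_mem' := ⟨0, Fin.elim0, by ext x; simp [sphereMonomial_apply]⟩
  mul_mem' := by
    rintro _ _ ⟨m, f, rfl⟩ ⟨m', f', rfl⟩
    exact ⟨m + m', Fin.append f f', by ext x; simp [sphereMonomial_apply, Fin.prod_univ_add]⟩

theorem sphereMonomials_separatesPoints {n : ℕ} (x y : USphere n) (hxy : x ≠ y) :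
    ∃ g ∈ sphereMonomials n, g x ≠ g y := by
  by_contra! h
  refine hxy (Subtype.ext (PiLp.ext fun i => ?_))
  simpa [sphereMonomial_apply] using h _ ⟨1, fun _ => i, rfl⟩

theorem continuous_vmfKernel (n : ℕ) (κ : ℝ) (x : USphere n) : Continuous (vmfKernel n κ x) := by
  unfold vmfKernel
  fun_prop

/-- Equal mean embeddings force equal integrals of every feature, hence of every monomial, because
the Taylor coefficients `κ ^ m / m!` are all nonzero. -/
theorem isCharacteristicOnSphere_vmfKernel (n : ℕ) {κ : ℝ} (hκ : 0 < κ) :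
    IsCharacteristicOnSphere (vmfKernel n κ) := by
  refine ⟨posSemidef_of_hasSum_mul (hasSum_vmfFeature_mul n hκ.le), fun μ x =>
    ContinuousMap.integrable_of_isFiniteMeasure _ ⟨_, continuous_vmfKernel n κ x⟩,
    fun μ ν h => μ.ext_of_integral_submonoid ν (sphereMonomials n)
      sphereMonomials_separatesPoints ?_⟩
  rintro _ ⟨m, f, rfl⟩
  have hf := integral_feature_eq_of_integral_kernel_eq (μ : Measure (USphere n)) ν
    (summable_norm_sq_vmfFeature n hκ.le) (hasSum_vmfFeature_mul n hκ.le) (congrFun h) ⟨m, f⟩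
  have hpos : (√(κ ^ m / m.factorial) : ℝ) ≠ 0 := by positivity
  simpa only [vmfFeature, ContinuousMap.smul_apply, smul_eq_mul, integral_const_mul,
    mul_right_inj' hpos] using hf

/-! ### Smoothness and the gradient bound -/

theorem contMDiff_vmfKernel (n : ℕ) (κ : ℝ) :
    ContMDiff ((𝓡 n).prod (𝓡 n)) 𝓘(ℝ, ℝ) ∞
      (fun p : USphere n × USphere n => vmfKernel n κ p.1 p.2) := by
  have : Fact (Module.finrank ℝ (EuclideanSpace ℝ (Fin (n + 1))) = n + 1) :=
    ⟨finrank_euclideanSpace_fin⟩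
  have hE : ContDiff ℝ ∞ fun p : EuclideanSpace ℝ (Fin (n + 1)) × EuclideanSpace ℝ (Fin (n + 1)) =>
      Real.exp (κ * inner ℝ p.1 p.2) :=
    (contDiff_const.mul (contDiff_fst.inner ℝ contDiff_snd)).exp
  exact hE.contMDiff.comp ((contMDiff_coe_sphere.comp contMDiff_fst).prodMk_space
    (contMDiff_coe_sphere.comp contMDiff_snd))

theorem contMDiff_vmfKernel_left (n : ℕ) (κ : ℝ) (y : USphere n) :
    ContMDiff (𝓡 n) 𝓘(ℝ, ℝ) ∞ (fun x => vmfKernel n κ x y) :=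
  (contMDiff_vmfKernel n κ).comp (contMDiff_id.prodMk contMDiff_const)

theorem mvfderiv_vmfKernel_left {n : ℕ} (κ : ℝ) (x y : USphere n) (v : TangentSpace (𝓡 n) x) :
    mvfderiv (𝓡 n) (fun z => vmfKernel n κ z y) x v =
      κ * vmfKernel n κ x y * inner ℝ (inclusionDeriv x v) (y : EuclideanSpace ℝ (Fin (n + 1))) := by
  have : Fact (Module.finrank ℝ (EuclideanSpace ℝ (Fin (n + 1))) = n + 1) :=
    ⟨finrank_euclideanSpace_fin⟩
  have hι : MDifferentiableAt (𝓡 n) 𝓘(ℝ, EuclideanSpace ℝ (Fin (n + 1)))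
      (fun z : USphere n => (z : EuclideanSpace ℝ (Fin (n + 1)))) x :=
    (contMDiff_coe_sphere (m := 1) x).mdifferentiableAt one_ne_zero
  have hE : HasFDerivAt (fun p : EuclideanSpace ℝ (Fin (n + 1)) =>
      Real.exp (κ * inner ℝ p (y : EuclideanSpace ℝ (Fin (n + 1))))) _
      (x : EuclideanSpace ℝ (Fin (n + 1))) :=
    (((hasFDerivAt_id _).inner ℝ (hasFDerivAt_const _ _)).const_mul κ).exp
  -- Tangent spaces of vector spaces are identified with the spaces themselves by definition.
  have hv : mvfderiv (𝓡 n) (fun z => vmfKernel n κ z y) x v = _ :=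
    DFunLike.congr_fun (hE.hasMFDerivAt.comp x hι.hasMFDerivAt).mfderiv v
  refine hv.trans ?_
  change vmfKernel n κ x y * (κ * fderivInnerCLM ℝ ((x : EuclideanSpace ℝ (Fin (n + 1))),
    (y : EuclideanSpace ℝ (Fin (n + 1)))) (inclusionDeriv x v, 0)) = _
  rw [fderivInnerCLM_apply, inner_zero_right, zero_add]
  ring

/-- If `df_x` is bounded by `C` with respect to the round metric, then so is the gradient: evaluate
`df_x` at the gradient `g` itself, where `df_x g` is the square of the length of `g`. -/
theorem roundNorm_sphereGradient_le {n : ℕ} {f : USphere n → ℝ} {x : USphere n} {C : ℝ} (hC : 0 ≤ C)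
    (h : ∀ v, mvfderiv (𝓡 n) f x v ≤ C * roundNorm x v) :
    roundNorm x (sphereGradient f x) ≤ C := by
  set g := sphereGradient f x
  have hg := h g
  rw [← roundMetric_sphereGradient] at hg
  have hnn : 0 ≤ roundMetric x g g := by
    rw [roundMetric_apply]
    exact real_inner_self_nonneg
  rw [← Real.sq_sqrt hnn, sq] at hg
  rcases (Real.sqrt_nonneg (roundMetric x g g)).eq_or_lt with h0 | hpos
  · exact h0.symm.trans_le hC
  · exact le_of_mul_le_mul_right hg hpos

theorem roundNorm_sphereGradient_vmfKernel_le {n : ℕ} {κ : ℝ} (hκ : 0 ≤ κ) (x y : USphere n) :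
    roundNorm x (sphereGradient (fun z => vmfKernel n κ z y) x) ≤ κ * Real.exp κ := by
  refine roundNorm_sphereGradient_le (by positivity) fun v => ?_
  have hy : ‖(y : EuclideanSpace ℝ (Fin (n + 1)))‖ = 1 := by simp
  have hv : roundNorm x v = ‖inclusionDeriv x v‖ := by
    rw [roundNorm, roundMetric_apply, real_inner_self_eq_norm_sq, Real.sqrt_sq (norm_nonneg _)]
  have hk : vmfKernel n κ x y ≤ Real.exp κ := by
    have hxy := real_inner_le_norm (x : EuclideanSpace ℝ (Fin (n + 1)))
      (y : EuclideanSpace ℝ (Fin (n + 1)))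
    rw [hy, norm_eq_of_mem_sphere, mul_one] at hxy
    exact Real.exp_le_exp.2 (mul_le_of_le_one_right hκ hxy)
  have hk0 : 0 ≤ vmfKernel n κ x y := (Real.exp_pos _).le
  have hin := real_inner_le_norm (inclusionDeriv x v) (y : EuclideanSpace ℝ (Fin (n + 1)))
  rw [hy, mul_one] at hin
  rw [mvfderiv_vmfKernel_left, hv]
  calc _ ≤ κ * vmfKernel n κ x y * ‖inclusionDeriv x v‖ := by gcongr
    _ ≤ _ := by gcongr

theorem mainTheorem11 (n : ℕ) (κ : ℝ) (hκ : 0 < κ) :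
    SphericalKernelRegularity (vmfKernel n κ) ∧
    ContMDiff ((𝓡 n).prod (𝓡 n)) 𝓘(ℝ, ℝ) ∞
      (fun p : USphere n × USphere n => vmfKernel n κ p.1 p.2) ∧
    (∀ x y : USphere n,
      roundNorm x (sphereGradient (fun z => vmfKernel n κ z y) x) ≤ κ * Real.exp κ) := by
  refine ⟨⟨isCharacteristicOnSphere_vmfKernel n hκ, ⟨κ * Real.exp κ, ?_⟩,
    fun x y => Real.exp_pos _, fun y => (contMDiff_vmfKernel_left n κ y).of_le (by simp)⟩,
    contMDiff_vmfKernel n κ, roundNorm_sphereGradient_vmfKernel_le hκ.le⟩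
  rintro _ ⟨p, rfl⟩
  exact roundNorm_sphereGradient_vmfKernel_le hκ.le p.1 p.2
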